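/- \textbf{Theorem (GCD Extension Theorem).} All polynomials are in $\mathbb{C}[x]$. For $f=\sum_i f_ix^i$ let $\|f\|=\big(\sum_i|f_i|^2\big)^{1/2}$, and let $\|(p,q)-(r,s)\|=\sqrt{\|p-r\|^2+\|q-s\|^2}$ be the distance between two pairs. Write $f\sim g$ if $f=\alpha g$ for some constant $\alpha\neq 0$. Let $\mathscr{P}_{m,n}$ be the set of pairs $(p,q)$ with $\deg p=m$ and $\deg q=n$ exactly ($m,n\ge 0$). For such a pair, $\gcd(p,q)$ denotes the set of all polynomials of highest degree dividing both $p$ and $q$ (a $\sim$-equivalence class). Let $\mathscr{P}^k_{m,n}\subset\mathscr{P}_{m,n}$ be the subset of pairs whose GCDs have degree $k$, and let $$\theta_k(p,q)=\inf\{\|(p,q)-(r,s)\| : (r,s)\in\mathscr{P}^k_{m,n}\}\qquad(\inf\emptyset=+\infty).$$ For $(p,q)\in\mathscr{P}_{m,n}$ and $\varepsilon>0$, a \emph{numerical GCD of $(p,q)$ within $\varepsilon$} is any element of $\gcd(\tilde p,\tilde q)$, where $(\tilde p,\tilde q)\in\mathscr{P}^{k'}_{m,n}$ satisfies $\|(\tilde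 p,\tilde q)-(p,q)\|=\theta_{k'}(p,q)$ with $k'=\max\{j:\theta_j(p,q)<\varepsilon\}$. Let $\gcd_\varepsilon(p,q)$ denote the set of all of them. For every $(\hat p,\hat q)\in\mathscr{P}^k_{m,n}$ there is a constant $\theta>0$ such that the following hold. 1. For every $(p,q)\in\mathscr{P}_{m,n}$ and every $\varepsilon$ with $\|(p,q)-(\hat p,\hat q)\|<\varepsilon<\theta$, a numerical GCD of $(p,q)$ within $\varepsilon$ exists, it is unique up to $\sim$ (that is, $\gcd_\varepsilon(p,q)$ is exactly one $\sim$-equivalence class), and it has degree $k$. 2. For every $\varepsilon\in(0,\theta)$, $\ \lim_{(p,q)\to(\hat p,\hat q)}\gcd_\varepsilon(p,q)=\gcd(\hat p,\hat q)$ in the following sense: for every $\hat u\in\gcd(\hat p,\hat q)$ and $\eta>0$ there is $\delta>0$ such that every $(p,q)\in\mathscr{P}_{m,n}$ with $\|(p,q)-(\hat p,\hat q)\|<\delta$ has some $u\in\gcd_\varepsilon(p,q)$ with $\|u-\hat u\|<\eta$. 3. For every $\varepsilon\in(0,\theta)$, $\ \gcd_\varepsilon(\hat p,\hat q)=\gcd(\hat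 p,\hat q)$. -/

import Mathlib

open Polynomial
open scoped ENNReal

namespace NumGCD

/-- The Euclidean norm of the coefficient vector of a complex polynomial. -/
noncomputable def polyNorm (f : ℂ[X]) : ℝ :=
  √(∑ i ∈ f.support, ‖f.coeff i‖ ^ 2)

/-- The distance between two polynomial pairs, `√(‖p - r‖² + ‖q - s‖²)`. -/
noncomputable def pairDist (a b : ℂ[X] × ℂ[X]) : ℝ :=
  √(polyNorm (a.1 - b.1) ^ 2 + polyNorm (a.2 - b.2) ^ 2)

/-- Pairs `(p, q)` with `deg p = m` and `deg q = n` exactly (so both are nonzero). -/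
def pairsOfDegree (m n : ℕ) : Set (ℂ[X] × ℂ[X]) :=
  {a | a.1.degree = m ∧ a.2.degree = n}

/-- The set of all exact GCDs of a pair: the common divisors of the highest degree
(not required to be monic). -/
def exactGCDs (a : ℂ[X] × ℂ[X]) : Set ℂ[X] :=
  {u | u ∣ a.1 ∧ u ∣ a.2 ∧ ∀ d : ℂ[X], d ∣ a.1 → d ∣ a.2 → d.degree ≤ u.degree}

/-- The GCD manifold of degree `k`: pairs of degrees exactly `m`, `n` with GCD degree `k`. -/
def gcdManifold (m n k : ℕ) : Set (ℂ[X] × ℂ[X]) :=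
  {a | a ∈ pairsOfDegree m n ∧ ∃ u ∈ exactGCDs a, u.degree = k}

/-- The distance from a pair to the GCD manifold of degree `k`, as an extended real
(`∞` when the manifold is empty, that is when `k > min m n`). -/
noncomputable def manifoldDist (m n k : ℕ) (a : ℂ[X] × ℂ[X]) : ℝ≥0∞ :=
  ⨅ b ∈ gcdManifold m n k, ENNReal.ofReal (pairDist a b)

/-- Two polynomials are equivalent if they differ by a nonzero constant factor. -/
def Sim (f g : ℂ[X]) : Prop :=
  ∃ α : ℂ, α ≠ 0 ∧ f = C α * g

/-- The set of all numerical GCDs within `ε` of a pair `a` of degrees `m`, `n`: exact GCDs of a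
pair `b` in the manifold of degree `k`, where `k` is the largest `j` for which the manifold of
degree `j` is at distance less than `ε` from `a`, and `b` realizes the distance from `a` to the
manifold of degree `k`. -/
def numericalGCDs (m n : ℕ) (ε : ℝ) (a : ℂ[X] × ℂ[X]) : Set ℂ[X] :=
  {u | ∃ k : ℕ, IsGreatest {j : ℕ | manifoldDist m n j a < ENNReal.ofReal ε} k ∧
    ∃ b ∈ gcdManifold m n k,
      ENNReal.ofReal (pairDist b a) = manifoldDist m n k a ∧ u ∈ exactGCDs b}

end NumGCD

/-!
The pairs whose GCD has degree `k` are the products `(u * v, u * w)` with `u` monic of degree `k`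
and `v`, `w` coprime of the complementary degrees. Let `a₀` be such a pair, coming from the triple
`z₀ = (u₀, v₀, w₀)`. Polynomials carry the Euclidean norm of their coefficient vectors, and pairs
the `ℓ²` product norm, so that `pairDist` is the distance of a Hilbert norm.

*Compactness.* The Landau and Mignotte bounds for the Mahler measure give
`‖f‖ * ‖g‖ ≤ C * ‖f * g‖` in bounded degree (`norm_mul_norm_le`). Hence the product map `prodPair`
is proper near a pair of exact degrees (`exists_isCompact_factors`), which has three consequences.
Pairs with GCD of degree greater than `k` stay away from `a₀` (`exists_pos_le_dist_of_lt`), so that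
the degree selected by the definition of a numerical GCD is `k` when `ε` is small and `a` is within `ε`
of `a₀`. The GCD manifold is locally compact at `a₀`, so nearest points exist
(`exists_pos_exists_nearest`). The factorization is unique over `a₀`, so on the manifold it depends
continuously on the pair at `a₀` (`exists_pos_dist_factors_lt`); this gives the convergence of the
numerical GCDs.

*Uniqueness of the nearest point.* Since `v₀` and `w₀` are coprime, the derivative of `prodPair` at
`z₀` is injective on the variations that keep `u` monic, and so `‖prodPair z₁ - prodPair z₂‖` is at
least a multiple of `‖z₁ - z₂‖` near `z₀` (`exists_mul_norm_sub_le`). As `prodPair` is quadratic,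
the product of the midpoint of two triples differs from the midpoint of their products by a quarter of
`prodPair (z₁ - z₂)`. If the two products were distinct points of the manifold nearest to `a`, the
parallelogram law would make the product of the midpoint triple, which again lies on the manifold,
closer to `a` than both of them (`exists_pos_nearest_unique`).
-/

namespace NumGCD

/-! ### The Euclidean structure on polynomials -/

/-- The Hermitian inner product `∑ i, conj (f i) * g i` of coefficient vectors. -/
@[reducible] noncomputable def innerCore : InnerProductSpace.Core ℂ ℂ[X] where
  inner f g := f.sum fun i a => (starRingEnd ℂ) a * g.coeff i
  conj_inner_symm f g := by
    have key : ∀ f g : ℂ[X], (f.sum fun i a => (starRingEnd ℂ) a * g.coeff i) =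
        ∑ i ∈ f.support ∪ g.support, (starRingEnd ℂ) (f.coeff i) * g.coeff i := fun f g =>
      sum_eq_of_subset _ (by simp) Finset.subset_union_left
    rw [key, key, map_sum, Finset.union_comm]
    exact Finset.sum_congr rfl fun i _ => by simp [mul_comm]
  re_inner_nonneg f := by
    rw [sum_def, map_sum]
    refine Finset.sum_nonneg fun i _ => ?_
    simp [Complex.conj_mul', ← Complex.ofReal_pow]
  add_left f g h := sum_add_index _ _ _ (by simp) (by simp [add_mul])
  smul_left f g r := by
    rw [sum_smul_index _ _ _ (by simp), sum_def, sum_def, Finset.mul_sum]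
    exact Finset.sum_congr rfl fun i _ => by simp [mul_assoc]
  definite f hf := by
    have h : ∑ i ∈ f.support, ‖f.coeff i‖ ^ 2 = 0 := by
      rw [sum_def] at hf
      simp only [Complex.conj_mul'] at hf
      exact_mod_cast hf
    ext i
    by_contra hi
    have := (Finset.sum_eq_zero_iff_of_nonneg (fun i _ => by positivity)).1 h i
      (mem_support_iff.2 hi)
    simp_all

/-- The norm on `ℂ[X]` is the Euclidean norm of the coefficient vector. -/
noncomputable instance : NormedAddCommGroup ℂ[X] := innerCore.toNormedAddCommGroup

noncomputable instance : InnerProductSpace ℂ ℂ[X] := InnerProductSpace.ofCore innerCore.toCore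

theorem polyNorm_eq_norm (f : ℂ[X]) : polyNorm f = ‖f‖ := by
  change √_ = √(RCLike.re (f.sum fun i a => (starRingEnd ℂ) a * f.coeff i))
  congr 1
  rw [sum_def, map_sum]
  refine Finset.sum_congr rfl fun i _ => ?_
  simp [Complex.conj_mul', ← Complex.ofReal_pow]

theorem norm_sq_eq_sum (f : ℂ[X]) : ‖f‖ ^ 2 = f.sum fun _ a => ‖a‖ ^ 2 := by
  rw [← polyNorm_eq_norm, polyNorm, Real.sq_sqrt (Finset.sum_nonneg fun i _ => by positivity),
    sum_def]

theorem norm_coeff_le (f : ℂ[X]) (i : ℕ) : ‖f.coeff i‖ ≤ ‖f‖ := by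
  by_cases hi : f.coeff i = 0
  · simp [hi]
  refine le_of_sq_le_sq ?_ (norm_nonneg f)
  rw [norm_sq_eq_sum, sum_def]
  exact Finset.single_le_sum (f := fun i => ‖f.coeff i‖ ^ 2) (fun i _ => by positivity)
    (mem_support_iff.2 hi)

theorem norm_X_mul (f : ℂ[X]) : ‖X * f‖ = ‖f‖ := by
  rw [← sq_eq_sq₀ (norm_nonneg _) (norm_nonneg _), norm_sq_eq_sum, norm_sq_eq_sum,
    sum_over_range' (X * f) (by simp) (f.natDegree + 2)
      (Nat.lt_succ_of_le (natDegree_mul_le.trans (by simp [add_comm]))),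
    sum_over_range f (by simp), Finset.sum_range_succ']
  simp

theorem norm_X_pow_mul (i : ℕ) (f : ℂ[X]) : ‖X ^ i * f‖ = ‖f‖ := by
  induction i with
  | zero => simp
  | succ i ih => rw [pow_succ', mul_assoc, norm_X_mul, ih]

theorem norm_one_eq : ‖(1 : ℂ[X])‖ = 1 := by
  rw [← sq_eq_sq₀ (norm_nonneg _) zero_le_one, norm_sq_eq_sum, ← C_1, sum_C_index (by simp)]
  simp

theorem continuous_coeff (i : ℕ) : Continuous fun f : ℂ[X] => f.coeff i :=
  AddMonoidHomClass.continuous_of_bound (lcoeff ℂ i) 1 fun f => by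
    simpa using norm_coeff_le f i

theorem continuous_X_pow_mul (i : ℕ) : Continuous fun f : ℂ[X] => X ^ i * f :=
  AddMonoidHomClass.continuous_of_bound (LinearMap.mulLeft ℂ (X ^ i)) 1 fun f => by
    simp [norm_X_pow_mul]

/-- On polynomials of bounded degree the product is a sum with a fixed number of terms, so that
its continuity and its bounds reduce to those of the coefficients and of `X ^ i * g`. -/
theorem mul_eq_sum_of_mem_degreeLT {N : ℕ} {f : ℂ[X]} (hf : f ∈ degreeLT ℂ N) (g : ℂ[X]) :
    f * g = ∑ i ∈ Finset.range N, f.coeff i • (X ^ i * g) := by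
  have hs : f.support ⊆ Finset.range N := fun i hi => Finset.mem_range.2 <| by
    exact_mod_cast (le_degree_of_mem_supp i hi).trans_lt (mem_degreeLT.1 hf)
  conv_lhs => rw [← sum_C_mul_X_pow_eq f, sum_eq_of_subset _ (by simp) hs, Finset.sum_mul]
  simp [smul_eq_C_mul, mul_assoc]

/-- Multiplication is not continuous on all of `ℂ[X]`, but it is once the degree of one factor
is bounded. -/
theorem continuousOn_mul (N : ℕ) :
    ContinuousOn (fun x : ℂ[X] × ℂ[X] => x.1 * x.2) {x | x.1 ∈ degreeLT ℂ N} := by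
  have : Continuous fun x : ℂ[X] × ℂ[X] =>
      ∑ i ∈ Finset.range N, x.1.coeff i • (X ^ i * x.2) :=
    continuous_finsetSum _ fun i _ =>
      ((continuous_coeff i).comp continuous_fst).smul
        ((continuous_X_pow_mul i).comp continuous_snd)
  exact this.continuousOn.congr fun x hx => mul_eq_sum_of_mem_degreeLT hx _

theorem norm_mul_le_of_mem_degreeLT {N : ℕ} {f : ℂ[X]} (hf : f ∈ degreeLT ℂ N) (g : ℂ[X]) :
    ‖f * g‖ ≤ N * (‖f‖ * ‖g‖) := by
  rw [mul_eq_sum_of_mem_degreeLT hf]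
  refine (norm_sum_le_of_le _ fun i _ => ?_).trans (by simp : ∑ _i ∈ Finset.range N, ‖f‖ * ‖g‖ ≤ _)
  rw [norm_smul, norm_X_pow_mul]
  gcongr
  exact norm_coeff_le f i

theorem mem_degreeLT_succ {N : ℕ} {f : ℂ[X]} : f ∈ degreeLT ℂ (N + 1) ↔ f.natDegree ≤ N := by
  rw [mem_degreeLT, degree_lt_iff_coeff_zero, natDegree_le_iff_coeff_eq_zero]
  rfl

theorem norm_le_two_pow_mul_mahlerMeasure {N : ℕ} {f : ℂ[X]} (hf : f ∈ degreeLT ℂ (N + 1)) :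
    ‖f‖ ≤ 2 ^ N * f.mahlerMeasure := by
  have hN : f.natDegree ≤ N := mem_degreeLT_succ.1 hf
  have h := mul_eq_sum_of_mem_degreeLT hf 1
  rw [mul_one] at h
  calc ‖f‖ = ‖∑ i ∈ Finset.range (N + 1), f.coeff i • (X ^ i * 1 : ℂ[X])‖ := by rw [← h]
    _ ≤ ∑ i ∈ Finset.range (N + 1), (N.choose i : ℝ) * f.mahlerMeasure := by
        refine norm_sum_le_of_le _ fun i _ => ?_
        rw [norm_smul, norm_X_pow_mul, norm_one_eq, mul_one]
        refine (norm_coeff_le_choose_mul_mahlerMeasure i f).trans ?_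
        gcongr
        exact f.mahlerMeasure_nonneg
    _ = 2 ^ N * f.mahlerMeasure := by
        rw [← Finset.sum_mul, ← Nat.cast_sum, Nat.sum_range_choose]; simp

/-- The Landau and Mignotte bounds, together with multiplicativity of the Mahler measure, bound
the product of the norms of two factors by the norm of their product. -/
theorem norm_mul_norm_le {M N : ℕ} {f g : ℂ[X]} (hf : f ∈ degreeLT ℂ (M + 1))
    (hg : g ∈ degreeLT ℂ (N + 1)) : ‖f‖ * ‖g‖ ≤ 2 ^ (M + N) * ‖f * g‖ := by
  have h : (f * g).mahlerMeasure ≤ ‖f * g‖ := by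
    rw [← polyNorm_eq_norm]
    exact mahlerMeasure_le_sqrt_sum_sq_norm_coeff _
  calc ‖f‖ * ‖g‖ ≤ (2 ^ M * f.mahlerMeasure) * (2 ^ N * g.mahlerMeasure) := by
        gcongr
        · exact mul_nonneg (by positivity) f.mahlerMeasure_nonneg
        · exact norm_le_two_pow_mul_mahlerMeasure hf
        · exact norm_le_two_pow_mul_mahlerMeasure hg
    _ = 2 ^ (M + N) * (f * g).mahlerMeasure := by rw [mahlerMeasure_mul]; ring
    _ ≤ _ := by gcongr

instance (N : ℕ) : FiniteDimensional ℂ (degreeLT ℂ N) :=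
  Module.Finite.equiv (degreeLTEquiv ℂ N).symm

theorem isCompact_degreeLT_inter_closedBall (N : ℕ) (R : ℝ) :
    IsCompact ((degreeLT ℂ N : Set ℂ[X]) ∩ Metric.closedBall 0 R) := by
  have : ProperSpace (degreeLT ℂ N) := FiniteDimensional.proper ℂ _
  convert (isCompact_closedBall (0 : degreeLT ℂ N) R).image continuous_subtype_val using 1
  ext f
  simp [and_comm]

/-! ### The product map on triples of polynomials -/

theorem pairDist_eq_dist (a b : ℂ[X] × ℂ[X]) :
    pairDist a b = dist (WithLp.toLp 2 a) (WithLp.toLp 2 b) := by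
  rw [WithLp.prod_dist_eq_of_L2, pairDist, polyNorm_eq_norm, polyNorm_eq_norm, dist_eq_norm,
    dist_eq_norm]
  rfl

theorem pairDist_nonneg (a b : ℂ[X] × ℂ[X]) : 0 ≤ pairDist a b := Real.sqrt_nonneg _

theorem norm_toLp_le (f g : ℂ[X]) : ‖WithLp.toLp 2 (f, g)‖ ≤ ‖f‖ + ‖g‖ := by
  rw [WithLp.prod_norm_eq_of_L2]
  exact Real.sqrt_le_iff.2 ⟨by positivity, by
    simp only [WithLp.toLp_fst, WithLp.toLp_snd]
    nlinarith [mul_nonneg (norm_nonneg f) (norm_nonneg g)]⟩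

theorem norm_fst_le (b : WithLp 2 (ℂ[X] × ℂ[X])) : ‖b.fst‖ ≤ ‖b‖ := by
  rw [WithLp.prod_norm_eq_of_L2]
  exact Real.le_sqrt_of_sq_le (by nlinarith [sq_nonneg ‖b.snd‖])

theorem norm_snd_le (b : WithLp 2 (ℂ[X] × ℂ[X])) : ‖b.snd‖ ≤ ‖b‖ := by
  rw [WithLp.prod_norm_eq_of_L2]
  exact Real.le_sqrt_of_sq_le (by nlinarith [sq_nonneg ‖b.fst‖])

/-- The pair `(u * v, u * w)` with common factor `u` and cofactors `v`, `w`, as a point of the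
Euclidean space of pairs. -/
noncomputable def prodPair (z : ℂ[X] × ℂ[X] × ℂ[X]) : WithLp 2 (ℂ[X] × ℂ[X]) :=
  WithLp.toLp 2 (z.1 * z.2.1, z.1 * z.2.2)

/-- Triples `(u, v, w)` with `u` monic of degree `k`, and `v`, `w` of degrees at most `m`, `n`. -/
def factors (k m n : ℕ) : Set (ℂ[X] × ℂ[X] × ℂ[X]) :=
  {z | z.1 ∈ degreeLT ℂ (k + 1) ∧ z.1.coeff k = 1 ∧ z.2.1 ∈ degreeLT ℂ (m + 1) ∧
    z.2.2 ∈ degreeLT ℂ (n + 1)}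

variable {k m n : ℕ}

theorem isCompact_factors_inter_closedBall (k m n : ℕ) (R : ℝ) :
    IsCompact (factors k m n ∩ Metric.closedBall 0 R) := by
  have h := ((isCompact_degreeLT_inter_closedBall (k + 1) R).prod
    ((isCompact_degreeLT_inter_closedBall (m + 1) R).prod
      (isCompact_degreeLT_inter_closedBall (n + 1) R))).inter_right
    (isClosed_eq ((continuous_coeff k).comp continuous_fst) continuous_const :
      IsClosed {z : ℂ[X] × ℂ[X] × ℂ[X] | z.1.coeff k = 1})
  convert h using 1
  ext z
  simp only [factors, Set.mem_inter_iff, Set.mem_ofPred_eq, Set.mem_prod, SetLike.mem_coe,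
    mem_closedBall_zero_iff, norm_prod_le_iff]
  tauto

theorem continuousOn_prodPair (k m n : ℕ) : ContinuousOn prodPair (factors k m n) := by
  refine (WithLp.prod_continuous_toLp 2 _ _).comp_continuousOn (ContinuousOn.prodMk ?_ ?_)
  · exact (continuousOn_mul (k + 1)).comp
      (f := fun z : ℂ[X] × ℂ[X] × ℂ[X] => (z.1, z.2.1)) (by fun_prop) fun z hz => hz.1
  · exact (continuousOn_mul (k + 1)).comp
      (f := fun z : ℂ[X] × ℂ[X] × ℂ[X] => (z.1, z.2.2)) (by fun_prop) fun z hz => hz.1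

theorem monic_of_mem_factors {z : ℂ[X] × ℂ[X] × ℂ[X]} (hz : z ∈ factors k m n) : z.1.Monic :=
  monic_of_natDegree_le_of_coeff_eq_one k (mem_degreeLT_succ.1 hz.1) hz.2.1

theorem natDegree_of_mem_factors {z : ℂ[X] × ℂ[X] × ℂ[X]} (hz : z ∈ factors k m n) :
    z.1.natDegree = k :=
  natDegree_eq_of_le_of_coeff_ne_zero (mem_degreeLT_succ.1 hz.1) (by simp [hz.2.1])

theorem natDegree_prodPair_fst_le {z : ℂ[X] × ℂ[X] × ℂ[X]} (hz : z ∈ factors k m n) :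
    (prodPair z).fst.natDegree ≤ k + m :=
  natDegree_mul_le_of_le (mem_degreeLT_succ.1 hz.1) (mem_degreeLT_succ.1 hz.2.2.1)

theorem natDegree_prodPair_snd_le {z : ℂ[X] × ℂ[X] × ℂ[X]} (hz : z ∈ factors k m n) :
    (prodPair z).snd.natDegree ≤ k + n :=
  natDegree_mul_le_of_le (mem_degreeLT_succ.1 hz.1) (mem_degreeLT_succ.1 hz.2.2.2)

theorem coeff_prodPair_fst {z : ℂ[X] × ℂ[X] × ℂ[X]} (hz : z ∈ factors k m n) :
    (prodPair z).fst.coeff (k + m) = z.2.1.coeff m := by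
  have := coeff_mul_add_eq_of_natDegree_le (mem_degreeLT_succ.1 hz.1) (mem_degreeLT_succ.1 hz.2.2.1)
  rwa [hz.2.1, one_mul] at this

/-- A point of `prodPair '' factors k m n` in a bounded region where the leading coefficient of the
first component is bounded away from zero comes from a bounded region of triples. -/
theorem norm_le_of_norm_prodPair_le {z : ℂ[X] × ℂ[X] × ℂ[X]} (hz : z ∈ factors k m n) {r B : ℝ}
    (hr : 0 < r) (hrz : r ≤ ‖(prodPair z).fst.coeff (k + m)‖) (hB : ‖prodPair z‖ ≤ B) :
    ‖z‖ ≤ max (2 ^ (k + m) * B / r) (max (2 ^ (k + m) * B) (2 ^ (k + n) * B)) := by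
  have h₁ : ‖z.1‖ * ‖z.2.1‖ ≤ 2 ^ (k + m) * B :=
    (norm_mul_norm_le hz.1 hz.2.2.1).trans (by gcongr; exact (norm_fst_le (prodPair z)).trans hB)
  have h₂ : ‖z.1‖ * ‖z.2.2‖ ≤ 2 ^ (k + n) * B :=
    (norm_mul_norm_le hz.1 hz.2.2.2).trans (by gcongr; exact (norm_snd_le (prodPair z)).trans hB)
  have hu : 1 ≤ ‖z.1‖ := by simpa [hz.2.1] using norm_coeff_le z.1 k
  have hv : r ≤ ‖z.2.1‖ := by
    rw [coeff_prodPair_fst hz] at hrz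
    exact hrz.trans (norm_coeff_le _ _)
  refine norm_prod_le_iff.2 ⟨le_max_of_le_left ?_, norm_prod_le_iff.2
    ⟨le_max_of_le_right (le_max_of_le_left ?_), le_max_of_le_right (le_max_of_le_right ?_)⟩⟩
  · rw [le_div_iff₀ hr]
    exact (by gcongr : ‖z.1‖ * r ≤ ‖z.1‖ * ‖z.2.1‖).trans h₁
  · exact (le_mul_of_one_le_left (norm_nonneg _) hu).trans h₁
  · exact (le_mul_of_one_le_left (norm_nonneg _) hu).trans h₂

/-! ### Pairs of exact degrees near a given pair -/

/-- A whole neighbourhood of the pair has leading coefficients bounded away from zero. -/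
theorem exists_pos_le_norm_coeff {M N : ℕ} {a : ℂ[X] × ℂ[X]} (ha : a ∈ pairsOfDegree M N) :
    ∃ r > 0, ∀ b : WithLp 2 (ℂ[X] × ℂ[X]), dist b (WithLp.toLp 2 a) ≤ r →
      r ≤ ‖b.fst.coeff M‖ ∧ r ≤ ‖b.snd.coeff N‖ := by
  have h₁ : 0 < ‖a.1.coeff M‖ := norm_pos_iff.2 (coeff_ne_zero_of_eq_degree ha.1)
  have h₂ : 0 < ‖a.2.coeff N‖ := norm_pos_iff.2 (coeff_ne_zero_of_eq_degree ha.2)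
  refine ⟨min ‖a.1.coeff M‖ ‖a.2.coeff N‖ / 2, by positivity, fun b hb => ?_⟩
  rw [dist_eq_norm] at hb
  have h₃ := (norm_coeff_le _ M).trans ((norm_fst_le _).trans hb)
  have h₄ := (norm_coeff_le _ N).trans ((norm_snd_le _).trans hb)
  simp only [WithLp.sub_fst, WithLp.sub_snd, WithLp.toLp_fst, WithLp.toLp_snd, coeff_sub] at h₃ h₄
  have h₅ := norm_sub_norm_le (a.1.coeff M) (b.fst.coeff M)
  have h₆ := norm_sub_norm_le (a.2.coeff N) (b.snd.coeff N)
  rw [norm_sub_rev] at h₅ h₆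
  have := min_le_left ‖a.1.coeff M‖ ‖a.2.coeff N‖
  have := min_le_right ‖a.1.coeff M‖ ‖a.2.coeff N‖
  constructor <;> linarith

theorem mem_pairsOfDegree_of_le {M N : ℕ} {b : WithLp 2 (ℂ[X] × ℂ[X])} (h₁ : b.fst.natDegree ≤ M)
    (h₂ : b.snd.natDegree ≤ N) {r : ℝ} (hr : 0 < r)
    (h : r ≤ ‖b.fst.coeff M‖ ∧ r ≤ ‖b.snd.coeff N‖) :
    b.ofLp ∈ pairsOfDegree M N :=
  ⟨degree_eq_of_le_of_coeff_ne_zero (degree_le_of_natDegree_le h₁)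
    (norm_pos_iff.1 (hr.trans_le h.1)), degree_eq_of_le_of_coeff_ne_zero
      (degree_le_of_natDegree_le h₂) (norm_pos_iff.1 (hr.trans_le h.2))⟩

/-- Near a pair of exact degrees, the product map is proper: the triples mapped into a small ball
lie in a compact set `K`, and their products still have exact degrees. -/
theorem exists_isCompact_factors {a : ℂ[X] × ℂ[X]} (ha : a ∈ pairsOfDegree (k + m) (k + n)) :
    ∃ r > 0, ∃ K : Set (ℂ[X] × ℂ[X] × ℂ[X]), IsCompact K ∧ K ⊆ factors k m n ∧
      (∀ z ∈ factors k m n, dist (prodPair z) (WithLp.toLp 2 a) ≤ r →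
        z ∈ K ∧ (prodPair z).ofLp ∈ pairsOfDegree (k + m) (k + n)) := by
  obtain ⟨r, hr, h⟩ := exists_pos_le_norm_coeff ha
  refine ⟨r, hr, _, isCompact_factors_inter_closedBall k m n _, Set.inter_subset_left,
    fun z hz hzr => ⟨⟨hz, mem_closedBall_zero_iff.2 (norm_le_of_norm_prodPair_le
      (B := ‖WithLp.toLp 2 a‖ + r) hz hr (h _ hzr).1 ?_)⟩, ?_⟩⟩
  · rw [dist_eq_norm] at hzr
    linarith [norm_sub_norm_le (prodPair z) (WithLp.toLp 2 a)]
  · exact mem_pairsOfDegree_of_le (natDegree_prodPair_fst_le hz) (natDegree_prodPair_snd_le hz) hr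
      (h _ hzr)

/-- If no triple outside the open set `U` is mapped to the pair `a`, then no such triple is mapped
near `a`. -/
theorem exists_pos_forall_mem_of_dist_lt {a : ℂ[X] × ℂ[X]}
    (ha : a ∈ pairsOfDegree (k + m) (k + n)) {U : Set (ℂ[X] × ℂ[X] × ℂ[X])} (hU : IsOpen U)
    (h : ∀ z ∈ factors k m n, prodPair z = WithLp.toLp 2 a → z ∈ U) :
    ∃ r > 0, ∀ z ∈ factors k m n, dist (prodPair z) (WithLp.toLp 2 a) < r → z ∈ U := by
  obtain ⟨r, hr, K, hK, hKf, hr'⟩ := exists_isCompact_factors ha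
  have hc : IsCompact (prodPair '' (K \ U)) :=
    (hK.diff hU).image_of_continuousOn
      ((continuousOn_prodPair k m n).mono (Set.sdiff_subset.trans hKf))
  have hna : WithLp.toLp 2 a ∉ prodPair '' (K \ U) := by
    rintro ⟨z, hz, hza⟩
    exact hz.2 (h z (hKf hz.1) hza)
  obtain ⟨s, hs, hsub⟩ := Metric.isOpen_iff.1 hc.isClosed.isOpen_compl _ hna
  refine ⟨min r s, lt_min hr hs, fun z hz hzd => ?_⟩
  by_contra hzU
  exact hsub (Metric.mem_ball.2 (hzd.trans_le (min_le_right _ _)))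
    ⟨z, ⟨(hr' z hz (hzd.le.trans (min_le_left _ _))).1, hzU⟩, rfl⟩

/-! ### Exact greatest common divisors -/

theorem associated_of_mem_exactGCDs {a : ℂ[X] × ℂ[X]} (ha : a.1 ≠ 0) {u d : ℂ[X]}
    (hu : u ∈ exactGCDs a) (hd₁ : d ∣ a.1) (hd₂ : d ∣ a.2) (hud : u.degree ≤ d.degree) :
    Associated d u := by
  classical
  have hg : EuclideanDomain.gcd a.1 a.2 ≠ 0 := fun h => ha (EuclideanDomain.gcd_eq_zero_iff.1 h).1
  have key : ∀ e : ℂ[X], e ∣ a.1 → e ∣ a.2 → u.degree ≤ e.degree →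
      Associated e (EuclideanDomain.gcd a.1 a.2) := fun e h₁ h₂ h =>
    associated_of_dvd_of_natDegree_le (EuclideanDomain.dvd_gcd h₁ h₂) hg <|
      natDegree_le_natDegree <| (hu.2.2 _ (EuclideanDomain.gcd_dvd_left _ _)
        (EuclideanDomain.gcd_dvd_right _ _)).trans h
  exact (key d hd₁ hd₂ hud).trans (key u hu.1 hu.2.1 le_rfl).symm

theorem sim_iff_associated {f g : ℂ[X]} : Sim f g ↔ Associated f g := by
  constructor
  · rintro ⟨α, hα, rfl⟩
    exact (associated_isUnit_mul_left_iff (isUnit_C.2 hα.isUnit)).2 (Associated.refl g)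
  · intro h
    obtain ⟨u, hu⟩ := h.symm
    obtain ⟨α, hα, hαu⟩ := isUnit_iff.1 u.isUnit
    exact ⟨α, hα.ne_zero, by rw [← hu, ← hαu, mul_comm]⟩

theorem exactGCDs_eq {a : ℂ[X] × ℂ[X]} (ha : a.1 ≠ 0) {u : ℂ[X]} (hu : u ∈ exactGCDs a) :
    exactGCDs a = {f | Sim f u} := by
  ext f
  rw [Set.mem_ofPred_eq, sim_iff_associated]
  refine ⟨fun hf => associated_of_mem_exactGCDs ha hu hf.1 hf.2.1 (hf.2.2 u hu.1 hu.2.1),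
    fun hf => ⟨hf.dvd.trans hu.1, hf.dvd.trans hu.2.1, fun d h₁ h₂ => ?_⟩⟩
  rw [degree_eq_degree_of_associated hf]
  exact hu.2.2 d h₁ h₂

theorem exists_mem_exactGCDs {a : ℂ[X] × ℂ[X]} (ha : a.1 ≠ 0) : ∃ u, u ∈ exactGCDs a := by
  classical
  have hg : EuclideanDomain.gcd a.1 a.2 ≠ 0 := fun h => ha (EuclideanDomain.gcd_eq_zero_iff.1 h).1
  exact ⟨EuclideanDomain.gcd a.1 a.2, EuclideanDomain.gcd_dvd_left _ _,
    EuclideanDomain.gcd_dvd_right _ _,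
    fun d h₁ h₂ => degree_le_of_dvd (EuclideanDomain.dvd_gcd h₁ h₂) hg⟩

theorem fst_ne_zero {M N : ℕ} {a : ℂ[X] × ℂ[X]} (ha : a ∈ pairsOfDegree M N) : a.1 ≠ 0 :=
  fun h => by simpa [h] using ha.1

/-- Over `ℂ`, a polynomial has monic divisors of every degree up to its own. -/
theorem exists_monic_natDegree_eq_dvd {f : ℂ[X]} (hf : f ≠ 0) {j : ℕ} (hj : j ≤ f.natDegree) :
    ∃ d : ℂ[X], d.Monic ∧ d.natDegree = j ∧ d ∣ f := by
  have hpos : 0 < (f.roots.powersetCard j).card := by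
    rw [Multiset.card_powersetCard, IsAlgClosed.card_roots_eq_natDegree]
    exact Nat.choose_pos hj
  obtain ⟨s, hs⟩ := Multiset.card_pos_iff_exists_mem.1 hpos
  obtain ⟨hs, hc⟩ := Multiset.mem_powersetCard.1 hs
  refine ⟨(s.map fun x => X - C x).prod, monic_multisetProd_X_sub_C s, ?_,
    (Multiset.prod_X_sub_C_dvd_iff_le_roots hf s).2 hs⟩
  rw [natDegree_multiset_prod_X_sub_C_eq_card, hc]

theorem exists_factors_of_dvd {a : ℂ[X] × ℂ[X]} (ha : a ∈ pairsOfDegree (k + m) (k + n)) {d : ℂ[X]}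
    (hd : d.Monic) (hk : d.natDegree = k) (h₁ : d ∣ a.1) (h₂ : d ∣ a.2) :
    ∃ z ∈ factors k m n, z.1 = d ∧ prodPair z = WithLp.toLp 2 a := by
  obtain ⟨v, hv⟩ := h₁
  obtain ⟨w, hw⟩ := h₂
  have hdeg : ∀ {f g : ℂ[X]} {l : ℕ}, f.degree = ↑(k + l) → f = d * g → g ∈ degreeLT ℂ (l + 1) := by
    rintro _ g l hf rfl
    have := natDegree_eq_of_degree_eq_some hf
    by_cases hg : g = 0
    · simp [hg]
    rw [hd.natDegree_mul' hg] at this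
    exact mem_degreeLT_succ.2 (by omega)
  refine ⟨(d, v, w), ⟨mem_degreeLT_succ.2 hk.le, ?_, hdeg ha.1 hv, hdeg ha.2 hw⟩, rfl, ?_⟩
  · rw [← hk]; exact hd
  · rw [prodPair, ← hv, ← hw]

theorem le_of_mem_gcdManifold {M N : ℕ} {a : ℂ[X] × ℂ[X]} (ha : a ∈ gcdManifold M N k) :
    k ≤ M ∧ k ≤ N := by
  obtain ⟨⟨h₁, h₂⟩, u, hu, huk⟩ := ha
  have hne : ∀ {f : ℂ[X]} {l : ℕ}, f.degree = l → f ≠ 0 := by rintro _ l h rfl; simp at h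
  have h₃ := degree_le_of_dvd hu.1 (hne h₁)
  have h₄ := degree_le_of_dvd hu.2.1 (hne h₂)
  rw [huk, h₁] at h₃
  rw [huk, h₂] at h₄
  exact ⟨by exact_mod_cast h₃, by exact_mod_cast h₄⟩

/-- A pair with GCD of degree at least `k` is the product of a triple whose common factor has degree
exactly `k`; hence the pairs with GCD of degree greater than `k` are all values of the product map
for `k + 1`. -/
theorem exists_factors_of_le {M N j : ℕ} {b : ℂ[X] × ℂ[X]} (hb : b ∈ gcdManifold M N j)
    (hkj : k ≤ j) (hM : M = k + m) (hN : N = k + n) :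
    ∃ z ∈ factors k m n, prodPair z = WithLp.toLp 2 b := by
  subst hM hN
  obtain ⟨hb, u, hu, huj⟩ := hb
  obtain ⟨d, hd, hdk, hdu⟩ := exists_monic_natDegree_eq_dvd (f := u) (j := k)
    (by rintro rfl; simp at huj) (by rwa [natDegree_eq_of_degree_eq_some huj])
  obtain ⟨z, hz, -, h⟩ := exists_factors_of_dvd hb hd hdk (hdu.trans hu.1) (hdu.trans hu.2.1)
  exact ⟨z, hz, h⟩

theorem dvd_of_prodPair_eq {z : ℂ[X] × ℂ[X] × ℂ[X]} {a : ℂ[X] × ℂ[X]}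
    (h : prodPair z = WithLp.toLp 2 a) : z.1 ∣ a.1 ∧ z.1 ∣ a.2 := by
  obtain rfl : (z.1 * z.2.1, z.1 * z.2.2) = a := congrArg WithLp.ofLp h
  exact ⟨dvd_mul_right _ _, dvd_mul_right _ _⟩

theorem degree_of_mem_factors {z : ℂ[X] × ℂ[X] × ℂ[X]} (hz : z ∈ factors k m n) :
    z.1.degree = k := by
  rw [degree_eq_natDegree (monic_of_mem_factors hz).ne_zero, natDegree_of_mem_factors hz]

/-- The common factor in any factorization of a pair of the GCD manifold is a GCD. -/
theorem fst_mem_exactGCDs {M N : ℕ} {z : ℂ[X] × ℂ[X] × ℂ[X]} (hz : z ∈ factors k m n)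
    {a : ℂ[X] × ℂ[X]} (ha : a ∈ gcdManifold M N k) (h : prodPair z = WithLp.toLp 2 a) :
    z.1 ∈ exactGCDs a := by
  obtain ⟨ha, u, hu, huk⟩ := ha
  obtain ⟨h₁, h₂⟩ := dvd_of_prodPair_eq h
  refine ⟨h₁, h₂, fun d hd₁ hd₂ => ?_⟩
  rw [degree_of_mem_factors hz, ← huk]
  exact hu.2.2 d hd₁ hd₂

theorem eq_of_prodPair_eq {M N : ℕ} {z z' : ℂ[X] × ℂ[X] × ℂ[X]} (hz : z ∈ factors k m n)
    (hz' : z' ∈ factors k m n) {a : ℂ[X] × ℂ[X]} (ha : a ∈ gcdManifold M N k)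
    (h : prodPair z = WithLp.toLp 2 a) (h' : prodPair z' = WithLp.toLp 2 a) : z = z' := by
  have h₁ : z.1 = z'.1 := eq_of_monic_of_associated (monic_of_mem_factors hz)
    (monic_of_mem_factors hz') (associated_of_mem_exactGCDs (fst_ne_zero ha.1)
      (fst_mem_exactGCDs hz' ha h') (dvd_of_prodPair_eq h).1 (dvd_of_prodPair_eq h).2
      (by rw [degree_of_mem_factors hz, degree_of_mem_factors hz']))
  have hne := (monic_of_mem_factors hz).ne_zero
  have h₂ : (z.1 * z.2.1, z.1 * z.2.2) = (z'.1 * z'.2.1, z'.1 * z'.2.2) :=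
    congrArg WithLp.ofLp (h.trans h'.symm)
  rw [← h₁, Prod.mk.injEq] at h₂
  exact Prod.ext h₁ (Prod.ext (mul_left_cancel₀ hne h₂.1) (mul_left_cancel₀ hne h₂.2))

theorem isCoprime_cofactors {M N : ℕ} {z : ℂ[X] × ℂ[X] × ℂ[X]} (hz : z ∈ factors k m n)
    {a : ℂ[X] × ℂ[X]} (ha : a ∈ gcdManifold M N k) (h : prodPair z = WithLp.toLp 2 a) :
    IsCoprime z.2.1 z.2.2 := by
  have hu := fst_mem_exactGCDs hz ha h
  have ha₀ := fst_ne_zero ha.1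
  obtain rfl : (z.1 * z.2.1, z.1 * z.2.2) = a := congrArg WithLp.ofLp h
  refine isCoprime_of_dvd _ _ (fun h0 => ha₀ (by simp [h0.1])) fun d hd hd₀ hd₁ hd₂ => hd ?_
  have hz0 := (monic_of_mem_factors hz).ne_zero
  have := associated_of_mem_exactGCDs ha₀ hu (mul_dvd_mul_left z.1 hd₁) (mul_dvd_mul_left z.1 hd₂)
    (by rw [degree_mul]; exact le_add_of_nonneg_right (zero_le_degree_iff.2 hd₀))
  refine isUnit_of_associated_mul (p := z.1) this hz0

/-! ### Semicontinuity of the degree of the GCD -/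

/-- The degree of the GCD does not increase near a given pair. -/
theorem exists_pos_le_dist_of_lt {M N : ℕ} {a : ℂ[X] × ℂ[X]} (ha : a ∈ gcdManifold M N k) :
    ∃ r > 0, ∀ j > k, ∀ b ∈ gcdManifold M N j,
      r ≤ dist (WithLp.toLp 2 b) (WithLp.toLp 2 a) := by
  by_cases hlt : k + 1 ≤ M ∧ k + 1 ≤ N
  · obtain ⟨⟨m, rfl⟩, ⟨n, rfl⟩⟩ := hlt.imp Nat.exists_eq_add_of_le Nat.exists_eq_add_of_le
    obtain ⟨r, hr, h⟩ := exists_pos_forall_mem_of_dist_lt ha.1 (isOpen_empty) fun z hz hza => by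
      obtain ⟨-, u, hu, huk⟩ := ha
      obtain ⟨h₁, h₂⟩ := dvd_of_prodPair_eq hza
      have := hu.2.2 _ h₁ h₂
      rw [degree_of_mem_factors hz, huk] at this
      exact absurd (show k + 1 ≤ k by exact_mod_cast this) (by omega)
    refine ⟨r, hr, fun j hj b hb => ?_⟩
    obtain ⟨z, hz, hzb⟩ := exists_factors_of_le hb hj rfl rfl
    by_contra! hlt
    exact h z hz (hzb ▸ hlt)
  · refine ⟨1, one_pos, fun j hj b hb => ?_⟩
    have := le_of_mem_gcdManifold hb
    omega

/-- Near a pair of the GCD manifold, the product map takes values in the manifold. -/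
theorem exists_pos_mem_gcdManifold {a : ℂ[X] × ℂ[X]}
    (ha : a ∈ gcdManifold (k + m) (k + n) k) :
    ∃ r > 0, ∀ z ∈ factors k m n, dist (prodPair z) (WithLp.toLp 2 a) < r →
      (prodPair z).ofLp ∈ gcdManifold (k + m) (k + n) k := by
  obtain ⟨r, hr, h⟩ := exists_pos_le_dist_of_lt ha
  obtain ⟨s, hs, K, -, -, h'⟩ := exists_isCompact_factors ha.1
  refine ⟨min r s, lt_min hr hs, fun z hz hzd => ?_⟩
  have hb := (h' z hz (hzd.le.trans (min_le_right _ _))).2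
  obtain ⟨u, hu⟩ := exists_mem_exactGCDs (fst_ne_zero hb)
  have hu0 : u ≠ 0 := by
    rintro rfl
    exact fst_ne_zero hb (zero_dvd_iff.1 hu.1)
  have hub : (prodPair z).ofLp ∈ gcdManifold (k + m) (k + n) u.natDegree :=
    ⟨hb, u, hu, degree_eq_natDegree hu0⟩
  have h₁ : k ≤ u.natDegree := by
    have := hu.2.2 z.1 (dvd_mul_right _ _) (dvd_mul_right _ _)
    rw [degree_of_mem_factors hz, degree_eq_natDegree hu0] at this
    exact_mod_cast this
  have h₂ : u.natDegree ≤ k := by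
    by_contra! hlt
    exact absurd (h _ hlt _ hub) (not_le.2 (hzd.trans_le (min_le_left _ _)))
  rwa [le_antisymm h₂ h₁] at hub

/-- The factorization of a pair of the GCD manifold depends continuously on the pair. -/
theorem exists_pos_dist_factors_lt {a : ℂ[X] × ℂ[X]} (ha : a ∈ gcdManifold (k + m) (k + n) k)
    {z₀ : ℂ[X] × ℂ[X] × ℂ[X]} (hz₀ : z₀ ∈ factors k m n) (h₀ : prodPair z₀ = WithLp.toLp 2 a)
    {δ : ℝ} (hδ : 0 < δ) :
    ∃ r > 0, ∀ z ∈ factors k m n, dist (prodPair z) (WithLp.toLp 2 a) < r → dist z z₀ < δ :=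
  exists_pos_forall_mem_of_dist_lt ha.1 (U := Metric.ball z₀ δ) Metric.isOpen_ball
    fun z hz hza => by
      rw [eq_of_prodPair_eq hz hz₀ ha hza h₀]
      exact Metric.mem_ball_self hδ

/-- Points of the GCD manifold in a small closed ball form a compact set. -/
theorem exists_pos_isCompact {a : ℂ[X] × ℂ[X]} (ha : a ∈ gcdManifold (k + m) (k + n) k) :
    ∃ r > 0, ∀ s < r, IsCompact ((WithLp.toLp 2 '' gcdManifold (k + m) (k + n) k) ∩
      Metric.closedBall (WithLp.toLp 2 a) s) := by
  obtain ⟨r, hr, h⟩ := exists_pos_mem_gcdManifold ha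
  obtain ⟨r', hr', K, hK, hKf, h'⟩ := exists_isCompact_factors ha.1
  refine ⟨min r r', lt_min hr hr', fun s hs => ?_⟩
  convert (hK.image_of_continuousOn ((continuousOn_prodPair k m n).mono hKf)).inter_right
    (Metric.isClosed_closedBall (x := WithLp.toLp 2 a) (ε := s)) using 1
  ext b
  constructor
  · rintro ⟨⟨b, hb, rfl⟩, hbs⟩
    obtain ⟨z, hz, hzb⟩ := exists_factors_of_le hb le_rfl rfl rfl
    rw [← hzb] at hbs ⊢
    exact ⟨⟨z, (h' z hz ((Metric.mem_closedBall.1 hbs).trans (hs.le.trans (min_le_right _ _)))).1, rfl⟩,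
      hbs⟩
  · rintro ⟨⟨z, hz, rfl⟩, hbs⟩
    exact ⟨⟨_, h z (hKf hz) (lt_of_le_of_lt hbs (hs.trans_le (min_le_left _ _))), rfl⟩, hbs⟩

/-! ### Injectivity of the product map to first order -/

/-- The derivative of `prodPair` at the triple `z`. -/
noncomputable def tangent (z : ℂ[X] × ℂ[X] × ℂ[X]) :
    ℂ[X] × ℂ[X] × ℂ[X] →ₗ[ℂ] WithLp 2 (ℂ[X] × ℂ[X]) where
  toFun h := WithLp.toLp 2 (z.1 * h.2.1 + h.1 * z.2.1, z.1 * h.2.2 + h.1 * z.2.2)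
  map_add' h h' := by
    rw [← WithLp.toLp_add, Prod.mk_add_mk]
    simp only [Prod.fst_add, Prod.snd_add]
    congr 2 <;> ring
  map_smul' c h := by
    rw [RingHom.id_apply, ← WithLp.toLp_smul, Prod.smul_mk]
    simp only [Prod.smul_fst, Prod.smul_snd]
    congr 2 <;> rw [smul_add, mul_smul_comm, smul_mul_assoc]

/-- The exact expansion of the quadratic map `prodPair`, with its derivative taken at a third
point `z₀`. -/
theorem prodPair_sub_prodPair (z₀ z₁ z₂ : ℂ[X] × ℂ[X] × ℂ[X]) :
    prodPair z₁ - prodPair z₂ =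
      tangent z₀ (z₁ - z₂) + (tangent (z₂ - z₀) (z₁ - z₂) + prodPair (z₁ - z₂)) := by
  simp only [prodPair, tangent, LinearMap.coe_mk, AddHom.coe_mk, ← WithLp.toLp_add,
    ← WithLp.toLp_sub, Prod.mk_add_mk, Prod.mk_sub_mk, Prod.fst_sub, Prod.snd_sub]
  congr 2 <;> ring

theorem norm_prodPair_le {h : ℂ[X] × ℂ[X] × ℂ[X]} {N : ℕ} (hh : h.1 ∈ degreeLT ℂ N) :
    ‖prodPair h‖ ≤ 2 * N * ‖h‖ ^ 2 := by
  have h₁ : ‖h.1‖ ≤ ‖h‖ := _root_.norm_fst_le h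
  have h₂ : ‖h.2.1‖ ≤ ‖h‖ := (_root_.norm_fst_le h.2).trans (_root_.norm_snd_le h)
  have h₃ : ‖h.2.2‖ ≤ ‖h‖ := (_root_.norm_snd_le h.2).trans (_root_.norm_snd_le h)
  calc ‖prodPair h‖ ≤ ‖h.1 * h.2.1‖ + ‖h.1 * h.2.2‖ := norm_toLp_le _ _
    _ ≤ N * (‖h‖ * ‖h‖) + N * (‖h‖ * ‖h‖) := by
      gcongr
      · exact (norm_mul_le_of_mem_degreeLT hh _).trans (by gcongr)
      · exact (norm_mul_le_of_mem_degreeLT hh _).trans (by gcongr)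
    _ = 2 * N * ‖h‖ ^ 2 := by ring

theorem norm_tangent_le {y h : ℂ[X] × ℂ[X] × ℂ[X]} {N : ℕ} (hy : y.1 ∈ degreeLT ℂ N)
    (hh : h.1 ∈ degreeLT ℂ N) : ‖tangent y h‖ ≤ 4 * N * (‖y‖ * ‖h‖) := by
  have h₁ : ∀ z : ℂ[X] × ℂ[X] × ℂ[X], ‖z.1‖ ≤ ‖z‖ := fun z => _root_.norm_fst_le z
  have h₂ : ∀ z : ℂ[X] × ℂ[X] × ℂ[X], ‖z.2.1‖ ≤ ‖z‖ := fun z =>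
    (_root_.norm_fst_le z.2).trans (_root_.norm_snd_le z)
  have h₃ : ∀ z : ℂ[X] × ℂ[X] × ℂ[X], ‖z.2.2‖ ≤ ‖z‖ := fun z =>
    (_root_.norm_snd_le z.2).trans (_root_.norm_snd_le z)
  have key : ∀ {f g f' g' : ℂ[X]}, f ∈ degreeLT ℂ N → f' ∈ degreeLT ℂ N → ‖f‖ ≤ ‖y‖ → ‖g‖ ≤ ‖h‖ →
      ‖f'‖ ≤ ‖h‖ → ‖g'‖ ≤ ‖y‖ → ‖f * g + f' * g'‖ ≤ 2 * N * (‖y‖ * ‖h‖) := by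
    intro f g f' g' hf hf' h₁ h₂ h₃ h₄
    calc ‖f * g + f' * g'‖ ≤ N * (‖f‖ * ‖g‖) + N * (‖f'‖ * ‖g'‖) :=
          norm_add_le_of_le (norm_mul_le_of_mem_degreeLT hf _) (norm_mul_le_of_mem_degreeLT hf' _)
      _ ≤ N * (‖y‖ * ‖h‖) + N * (‖h‖ * ‖y‖) := by gcongr
      _ = 2 * N * (‖y‖ * ‖h‖) := by ring
  calc ‖tangent y h‖ ≤ _ := norm_toLp_le _ _
    _ ≤ 2 * N * (‖y‖ * ‖h‖) + 2 * N * (‖y‖ * ‖h‖) :=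
      add_le_add (key hy hh (h₁ y) (h₂ h) (h₁ h) (h₂ y)) (key hy hh (h₁ y) (h₃ h) (h₁ h) (h₃ y))
    _ = _ := by ring

/-- The derivative of the product map is injective on variations that keep the common factor monic,
when the cofactors are coprime. -/
theorem eq_zero_of_tangent_eq_zero {z h : ℂ[X] × ℂ[X] × ℂ[X]} (hz : z ∈ factors k m n)
    (hco : IsCoprime z.2.1 z.2.2) (hh : h.1 ∈ degreeLT ℂ k) (h0 : tangent z h = 0) : h = 0 := by
  have h₀ : (z.1 * h.2.1 + h.1 * z.2.1, z.1 * h.2.2 + h.1 * z.2.2) = (0, 0) :=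
    congrArg WithLp.ofLp h0
  obtain ⟨h₁, h₂⟩ := Prod.mk.inj h₀
  obtain ⟨α, β, hαβ⟩ := hco
  have hdvd : z.1 ∣ h.1 := ⟨-(α * h.2.1 + β * h.2.2), by
    linear_combination α * h₁ + β * h₂ - h.1 * hαβ⟩
  have hne := (monic_of_mem_factors hz).ne_zero
  have hh1 : h.1 = 0 := eq_zero_of_dvd_of_degree_lt hdvd (by
    rw [degree_eq_natDegree hne, natDegree_of_mem_factors hz]
    exact mem_degreeLT.1 hh)
  rw [hh1, zero_mul, add_zero] at h₁ h₂
  exact Prod.ext hh1 (Prod.ext ((mul_eq_zero.1 h₁).resolve_left hne)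
    ((mul_eq_zero.1 h₂).resolve_left hne))

/-- Injectivity of the derivative is quantitative because the space of variations is
finite-dimensional. -/
theorem exists_norm_le_mul_norm_tangent {z : ℂ[X] × ℂ[X] × ℂ[X]} (hz : z ∈ factors k m n)
    (hco : IsCoprime z.2.1 z.2.2) :
    ∃ K > 0, ∀ h : ℂ[X] × ℂ[X] × ℂ[X], h.1 ∈ degreeLT ℂ k → h.2.1 ∈ degreeLT ℂ (m + 1) →
      h.2.2 ∈ degreeLT ℂ (n + 1) → ‖h‖ ≤ K * ‖tangent z h‖ := by
  let T : degreeLT ℂ k × degreeLT ℂ (m + 1) × degreeLT ℂ (n + 1) →ₗ[ℂ]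
      WithLp 2 (ℂ[X] × ℂ[X]) :=
    tangent z ∘ₗ (degreeLT ℂ k).subtype.prodMap
      ((degreeLT ℂ (m + 1)).subtype.prodMap (degreeLT ℂ (n + 1)).subtype)
  obtain ⟨K, hK, h⟩ := T.exists_antilipschitzWith <| LinearMap.ker_eq_bot'.2 fun x hx => by
    have := eq_zero_of_tangent_eq_zero hz hco x.1.2 hx
    simpa [Prod.ext_iff] using this
  refine ⟨K, hK, fun x h₁ h₂ h₃ => ?_⟩
  have := h.le_mul_dist (⟨x.1, h₁⟩, ⟨x.2.1, h₂⟩, ⟨x.2.2, h₃⟩) 0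
  rwa [map_zero, dist_zero_right, dist_zero_right] at this

/-- The difference of two monic polynomials of degree `k` has degree less than `k`. -/
theorem sub_mem_of_mem_factors {z z' : ℂ[X] × ℂ[X] × ℂ[X]} (hz : z ∈ factors k m n)
    (hz' : z' ∈ factors k m n) : (z - z').1 ∈ degreeLT ℂ k ∧ (z - z').2.1 ∈ degreeLT ℂ (m + 1) ∧
      (z - z').2.2 ∈ degreeLT ℂ (n + 1) := by
  refine ⟨mem_degreeLT.2 ((degree_lt_iff_coeff_zero _ _).2 fun i hi => ?_),
    sub_mem hz.2.2.1 hz'.2.2.1, sub_mem hz.2.2.2 hz'.2.2.2⟩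
  rcases hi.eq_or_lt with rfl | hi
  · simp [hz.2.1, hz'.2.1]
  · exact (degree_lt_iff_coeff_zero _ _).1 (mem_degreeLT.1 (sub_mem hz.1 hz'.1)) i hi

/-- Near a triple with coprime cofactors, the product map expands distances by at least a fixed
positive factor. -/
theorem exists_mul_norm_sub_le {z₀ : ℂ[X] × ℂ[X] × ℂ[X]} (hz₀ : z₀ ∈ factors k m n)
    (hco : IsCoprime z₀.2.1 z₀.2.2) :
    ∃ c > 0, ∃ δ > 0, ∀ z₁ ∈ factors k m n, ∀ z₂ ∈ factors k m n, dist z₁ z₀ < δ →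
      dist z₂ z₀ < δ → c * ‖z₁ - z₂‖ ≤ ‖prodPair z₁ - prodPair z₂‖ := by
  obtain ⟨K, hK, h⟩ := exists_norm_le_mul_norm_tangent hz₀ hco
  refine ⟨1 / (2 * K), by positivity, 1 / (16 * (k + 1 : ℕ) * K), by positivity,
    fun z₁ hz₁ z₂ hz₂ h₁ h₂ => ?_⟩
  -- With this `δ`, each of the two error terms in `prodPair_sub_prodPair` is at most a quarter of
  -- the lower bound `‖z₁ - z₂‖ / K` for the main term.
  set δ : ℝ := 1 / (16 * (k + 1 : ℕ) * K) with hδ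
  obtain ⟨m₁, m₂, m₃⟩ := sub_mem_of_mem_factors hz₁ hz₂
  have hT := h _ m₁ m₂ m₃
  have m₁' : (z₁ - z₂).1 ∈ degreeLT ℂ (k + 1) := sub_mem hz₁.1 hz₂.1
  have hle : ‖z₁ - z₂‖ ≤ 2 * δ := by
    rw [← dist_eq_norm]
    linarith [dist_triangle_right z₁ z₂ z₀]
  have e₁ : ‖tangent (z₂ - z₀) (z₁ - z₂)‖ ≤ 4 * (k + 1 : ℕ) * (δ * ‖z₁ - z₂‖) := by
    refine (norm_tangent_le (sub_mem hz₂.1 hz₀.1) m₁').trans ?_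
    gcongr
    rw [← dist_eq_norm]
    exact h₂.le
  have e₂ : ‖prodPair (z₁ - z₂)‖ ≤ 4 * (k + 1 : ℕ) * (δ * ‖z₁ - z₂‖) := by
    refine (norm_prodPair_le m₁').trans ?_
    rw [sq]
    nlinarith [mul_le_mul_of_nonneg_right hle (norm_nonneg (z₁ - z₂)),
      (Nat.cast_nonneg (k + 1) : (0 : ℝ) ≤ (k + 1 : ℕ))]
  have e₃ : 4 * (k + 1 : ℕ) * (δ * ‖z₁ - z₂‖) = 1 / (4 * K) * ‖z₁ - z₂‖ := by
    rw [hδ]; field_simp; ring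
  have e₄ : 1 / K * ‖z₁ - z₂‖ ≤ ‖tangent z₀ (z₁ - z₂)‖ := by
    rw [one_div, inv_mul_le_iff₀ hK]; exact hT
  have e₅ := norm_sub_norm_le (tangent z₀ (z₁ - z₂))
    (-(tangent (z₂ - z₀) (z₁ - z₂) + prodPair (z₁ - z₂)))
  rw [sub_neg_eq_add, ← prodPair_sub_prodPair, norm_neg] at e₅
  have e₆ := norm_add_le (tangent (z₂ - z₀) (z₁ - z₂)) (prodPair (z₁ - z₂))
  have e₇ : 1 / (2 * K) * ‖z₁ - z₂‖ = 1 / K * ‖z₁ - z₂‖ - 2 * (1 / (4 * K) * ‖z₁ - z₂‖) := by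
    field_simp; ring
  linarith

/-- The parallelogram identity for the quadratic map `prodPair`. -/
theorem prodPair_midpoint (z₁ z₂ : ℂ[X] × ℂ[X] × ℂ[X]) :
    prodPair ((2⁻¹ : ℂ) • (z₁ + z₂)) =
      (2⁻¹ : ℂ) • (prodPair z₁ + prodPair z₂) - (4⁻¹ : ℂ) • prodPair (z₁ - z₂) := by
  have h2 : (C (2⁻¹ : ℂ) : ℂ[X]) = 2 * C 4⁻¹ := by
    rw [← C_ofNat, ← C_mul]; norm_num
  have h4 : (4 * C (4⁻¹ : ℂ) : ℂ[X]) = 1 := by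
    rw [← C_ofNat, ← C_mul]; norm_num
  simp only [prodPair, ← WithLp.toLp_add, ← WithLp.toLp_sub, ← WithLp.toLp_smul, Prod.mk_add_mk,
    Prod.mk_sub_mk, Prod.smul_mk, Prod.fst_sub, Prod.snd_sub, Prod.fst_add, Prod.snd_add,
    Prod.smul_fst, Prod.smul_snd, smul_eq_C_mul, h2]
  congr 2
  · linear_combination C (4⁻¹ : ℂ) * ((z₁.1 + z₂.1) * (z₁.2.1 + z₂.2.1)) * h4
  · linear_combination C (4⁻¹ : ℂ) * ((z₁.1 + z₂.1) * (z₁.2.2 + z₂.2.2)) * h4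

theorem midpoint_mem_factors {z₁ z₂ : ℂ[X] × ℂ[X] × ℂ[X]} (hz₁ : z₁ ∈ factors k m n)
    (hz₂ : z₂ ∈ factors k m n) : (2⁻¹ : ℂ) • (z₁ + z₂) ∈ factors k m n := by
  refine ⟨Submodule.smul_mem _ _ (add_mem hz₁.1 hz₂.1), ?_,
    Submodule.smul_mem _ _ (add_mem hz₁.2.2.1 hz₂.2.2.1),
    Submodule.smul_mem _ _ (add_mem hz₁.2.2.2 hz₂.2.2.2)⟩
  simp [hz₁.2.1, hz₂.2.1]
  norm_num

theorem dist_midpoint_lt {z₀ z₁ z₂ : ℂ[X] × ℂ[X] × ℂ[X]} {δ : ℝ} (h₁ : dist z₁ z₀ < δ)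
    (h₂ : dist z₂ z₀ < δ) : dist ((2⁻¹ : ℂ) • (z₁ + z₂)) z₀ < δ := by
  have : (2⁻¹ : ℂ) • (z₁ + z₂) - z₀ = (2⁻¹ : ℂ) • ((z₁ - z₀) + (z₂ - z₀)) := by
    have h : z₀ = (2⁻¹ : ℂ) • (z₀ + z₀) := by rw [← two_smul ℂ z₀, smul_smul]; norm_num
    conv_lhs => rw [h]
    rw [← smul_sub]; congr 1; abel
  rw [dist_eq_norm] at *
  rw [this, norm_smul, norm_inv, Complex.norm_ofNat]
  linarith [norm_add_le (z₁ - z₀) (z₂ - z₀)]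

/-! ### Nearest points of the GCD manifold -/

theorem exists_pos_exists_nearest {a₀ : ℂ[X] × ℂ[X]} (ha₀ : a₀ ∈ gcdManifold (k + m) (k + n) k) :
    ∃ θ > 0, ∀ a, dist (WithLp.toLp 2 a) (WithLp.toLp 2 a₀) < θ →
      ∃ b ∈ gcdManifold (k + m) (k + n) k, ∀ c ∈ gcdManifold (k + m) (k + n) k,
        dist (WithLp.toLp 2 b) (WithLp.toLp 2 a) ≤ dist (WithLp.toLp 2 c) (WithLp.toLp 2 a) := by
  obtain ⟨r, hr, hK⟩ := exists_pos_isCompact ha₀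
  refine ⟨r / 4, by positivity, fun a ha => ?_⟩
  obtain ⟨-, ⟨⟨b, hb, rfl⟩, -⟩, hmin⟩ := (hK (r / 2) (by linarith)).exists_isMinOn
    ⟨_, ⟨a₀, ha₀, rfl⟩, Metric.mem_closedBall_self (by positivity)⟩
    (f := fun x => dist x (WithLp.toLp 2 a)) (by fun_prop)
  have hmin := isMinOn_iff.1 hmin
  refine ⟨b, hb, fun c hc => ?_⟩
  by_cases hcr : dist (WithLp.toLp 2 c) (WithLp.toLp 2 a₀) ≤ r / 2
  · exact hmin _ ⟨⟨c, hc, rfl⟩, hcr⟩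
  · -- Outside the ball, `c` is farther from `a` than `a₀` is.
    have h₁ := hmin _ ⟨⟨a₀, ha₀, rfl⟩, Metric.mem_closedBall_self (by positivity)⟩
    rw [dist_comm (WithLp.toLp 2 a₀)] at h₁
    linarith [dist_triangle (WithLp.toLp 2 c) (WithLp.toLp 2 a) (WithLp.toLp 2 a₀)]

/-- Nearest points are unique near a point of the GCD manifold. If `b₁`, `b₂` are the products of
nearby triples with difference `h`, then the product of the midpoint triple lies on the manifold and
differs from the midpoint of `b₁` and `b₂` by `O(‖h‖²)`. The latter midpoint is closer to `a` than
the common distance `t` of `b₁` and `b₂` by at least `‖b₁ - b₂‖² / (8 t)`, which is at least a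
multiple of `‖h‖² / t`; this is impossible when `t` is small, unless `h = 0`. -/
theorem exists_pos_nearest_unique {a₀ : ℂ[X] × ℂ[X]} (ha₀ : a₀ ∈ gcdManifold (k + m) (k + n) k) :
    ∃ θ > 0, ∀ a, dist (WithLp.toLp 2 a) (WithLp.toLp 2 a₀) < θ →
      ∀ b₁ ∈ gcdManifold (k + m) (k + n) k, ∀ b₂ ∈ gcdManifold (k + m) (k + n) k,
      (∀ c ∈ gcdManifold (k + m) (k + n) k,
        dist (WithLp.toLp 2 b₁) (WithLp.toLp 2 a) ≤ dist (WithLp.toLp 2 c) (WithLp.toLp 2 a)) →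
      (∀ c ∈ gcdManifold (k + m) (k + n) k,
        dist (WithLp.toLp 2 b₂) (WithLp.toLp 2 a) ≤ dist (WithLp.toLp 2 c) (WithLp.toLp 2 a)) →
      b₁ = b₂ := by
  obtain ⟨z₀, hz₀, hza₀⟩ := exists_factors_of_le ha₀ le_rfl rfl rfl
  obtain ⟨c, hc, δ₁, hδ₁, hexp⟩ := exists_mul_norm_sub_le hz₀ (isCoprime_cofactors hz₀ ha₀ hza₀)
  obtain ⟨r, hr, hmem⟩ := exists_pos_mem_gcdManifold ha₀
  obtain ⟨δ₂, hδ₂, hcont⟩ := Metric.continuousOn_iff.1 (continuousOn_prodPair k m n) z₀ hz₀ r hr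
  obtain ⟨ρ, hρ, hinv⟩ := exists_pos_dist_factors_lt ha₀ hz₀ hza₀ (lt_min hδ₁ hδ₂)
  rw [hza₀] at hcont
  refine ⟨min (ρ / 2) (c ^ 2 / (4 * (k + 1 : ℕ))), by positivity,
    fun a ha b₁ hb₁ b₂ hb₂ hmin₁ hmin₂ => ?_⟩
  obtain ⟨z₁, hz₁, hzb₁⟩ := exists_factors_of_le hb₁ le_rfl rfl rfl
  obtain ⟨z₂, hz₂, hzb₂⟩ := exists_factors_of_le hb₂ le_rfl rfl rfl
  rw [← hzb₁] at hmin₁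
  rw [← hzb₂] at hmin₂
  set A := WithLp.toLp 2 a
  set A₀ := WithLp.toLp 2 a₀
  have ht₁ := hmin₁ a₀ ha₀
  have ht₂ : dist (prodPair z₂) A = dist (prodPair z₁) A :=
    le_antisymm (by simpa [hzb₁] using hmin₂ b₁ hb₁) (by simpa [hzb₂] using hmin₁ b₂ hb₂)
  set t := dist (prodPair z₁) A
  rw [dist_comm A₀] at ht₁
  have htρ := ha.trans_le (min_le_left _ _)
  have htc := ha.trans_le (min_le_right _ _)
  have hd₁ : dist z₁ z₀ < min δ₁ δ₂ :=
    hinv z₁ hz₁ (by linarith [dist_triangle (prodPair z₁) A A₀])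
  have hd₂ : dist z₂ z₀ < min δ₁ δ₂ :=
    hinv z₂ hz₂ (by linarith [dist_triangle (prodPair z₂) A A₀])
  have hmid := midpoint_mem_factors hz₁ hz₂
  have hle : t ≤ dist (prodPair ((2⁻¹ : ℂ) • (z₁ + z₂))) A :=
    hmin₁ _ (hmem _ hmid (hcont _ hmid ((dist_midpoint_lt hd₁ hd₂).trans_le (min_le_right _ _))))
  have hexp := hexp z₁ hz₁ z₂ hz₂ (hd₁.trans_le (min_le_left _ _)) (hd₂.trans_le (min_le_left _ _))
  have hquad := norm_prodPair_le (h := z₁ - z₂) (sub_mem hz₁.1 hz₂.1)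
  have hpar := parallelogram_law_with_norm ℂ (prodPair z₁ - A) (prodPair z₂ - A)
  set s := ‖(2⁻¹ : ℂ) • ((prodPair z₁ - A) + (prodPair z₂ - A))‖ with hs
  have hs2 : ‖(prodPair z₁ - A) + (prodPair z₂ - A)‖ = 2 * s := by
    rw [hs, norm_smul, norm_inv, Complex.norm_ofNat]; ring
  rw [hs2, sub_sub_sub_cancel_right, ← dist_eq_norm _ A, ← dist_eq_norm _ A, ht₂] at hpar
  -- `s` is the distance from `a` to the midpoint of `b₁` and `b₂`, so `hpar` says
  -- `4 * s ^ 2 + ‖b₁ - b₂‖ ^ 2 = 4 * t ^ 2`, while minimality of `t` bounds `t - s` from above.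
  have hts : t ≤ s + 4⁻¹ * ‖prodPair (z₁ - z₂)‖ := by
    have : prodPair ((2⁻¹ : ℂ) • (z₁ + z₂)) - A =
        (2⁻¹ : ℂ) • ((prodPair z₁ - A) + (prodPair z₂ - A)) - (4⁻¹ : ℂ) • prodPair (z₁ - z₂) := by
      rw [prodPair_midpoint]
      module
    rw [dist_eq_norm, this] at hle
    refine hle.trans ((norm_sub_le _ _).trans_eq ?_)
    rw [norm_smul (4⁻¹ : ℂ), norm_inv, Complex.norm_ofNat]
  by_cases hh : z₁ = z₂
  · rw [hh, hzb₂] at hzb₁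
    exact (congrArg WithLp.ofLp hzb₁).symm
  exfalso
  have hpos : 0 < ‖z₁ - z₂‖ := norm_pos_iff.2 (sub_ne_zero.2 hh)
  have hs0 : 0 ≤ s := norm_nonneg _
  have ht0 : 0 ≤ t := dist_nonneg
  have hst : s ≤ t := abs_le_of_sq_le_sq' (by nlinarith [norm_nonneg (prodPair z₁ - prodPair z₂)])
    ht0 |>.2
  have hsq : (c * ‖z₁ - z₂‖) ^ 2 ≤ ‖prodPair z₁ - prodPair z₂‖ ^ 2 := by gcongr
  have hN : (0 : ℝ) < (k + 1 : ℕ) := by positivity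
  have h₁ : c ^ 2 * ‖z₁ - z₂‖ ^ 2 ≤ 4 * (k + 1 : ℕ) * t * ‖z₁ - z₂‖ ^ 2 := by
    have h₂ : (t - s) * (t + s) ≤ (4⁻¹ * (2 * (k + 1 : ℕ) * ‖z₁ - z₂‖ ^ 2)) * (2 * t) := by
      apply mul_le_mul _ (by linarith) (by linarith) (by positivity)
      linarith
    nlinarith
  have h₂ := le_of_mul_le_mul_right h₁ (by positivity)
  rw [lt_div_iff₀ (by positivity)] at htc
  nlinarith

/-! ### Numerical greatest common divisors near a pair of the GCD manifold -/

/-- Close to a pair of the GCD manifold, the numerical GCDs of a pair are the exact GCDs of its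
nearest point on that manifold. -/
theorem exists_pos_numericalGCDs_eq {a₀ : ℂ[X] × ℂ[X]}
    (ha₀ : a₀ ∈ gcdManifold (k + m) (k + n) k) :
    ∃ θ > 0, ∀ a, ∀ ε : ℝ, pairDist a a₀ < ε → ε < θ →
      ∃ b ∈ gcdManifold (k + m) (k + n) k,
        numericalGCDs (k + m) (k + n) ε a = exactGCDs b ∧ pairDist b a ≤ pairDist a₀ a := by
  obtain ⟨θ₁, hθ₁, hex⟩ := exists_pos_exists_nearest ha₀
  obtain ⟨θ₂, hθ₂, huniq⟩ := exists_pos_nearest_unique ha₀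
  obtain ⟨r, hr, hsep⟩ := exists_pos_le_dist_of_lt ha₀
  refine ⟨min (r / 2) (min θ₁ θ₂), by positivity, fun a ε haε hε => ?_⟩
  simp only [lt_min_iff] at hε
  simp only [← pairDist_eq_dist] at hex huniq hsep
  have hε0 : 0 < ε := (pairDist_nonneg _ _).trans_lt haε
  obtain ⟨b, hb, hmin⟩ := hex a (haε.trans hε.2.1)
  have hcomm : ∀ x y : ℂ[X] × ℂ[X], pairDist x y = pairDist y x := fun x y => by
    rw [pairDist_eq_dist, dist_comm, pairDist_eq_dist]
  have hdist : manifoldDist (k + m) (k + n) k a = ENNReal.ofReal (pairDist b a) := by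
    refine le_antisymm ((iInf₂_le b hb).trans_eq (by rw [hcomm])) (le_iInf₂ fun c hc => ?_)
    rw [hcomm a]
    exact ENNReal.ofReal_le_ofReal (hmin c hc)
  have hgreat : IsGreatest {j : ℕ | manifoldDist (k + m) (k + n) j a < ENNReal.ofReal ε} k := by
    constructor
    · rw [Set.mem_ofPred_eq, hdist, ENNReal.ofReal_lt_ofReal_iff hε0]
      exact (hmin a₀ ha₀).trans_lt (by rwa [hcomm])
    · intro j hj
      by_contra! hkj
      -- A pair with GCD of degree `j > k` is at distance at least `r > 2 * ε` from `a₀`, hence more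
      -- than `ε` from `a`.
      refine absurd hj (not_lt.2 (le_iInf₂ fun c hc => ENNReal.ofReal_le_ofReal ?_))
      have h₁ := hsep j hkj c hc
      have h₂ : pairDist c a₀ ≤ pairDist a c + pairDist a a₀ := by
        simp only [pairDist_eq_dist]
        exact dist_triangle_left _ _ _
      linarith
  refine ⟨b, hb, ?_, hmin a₀ ha₀⟩
  ext u
  constructor
  · rintro ⟨j, hj, b', hb', hb'a, hu⟩
    obtain rfl := hj.unique hgreat
    rw [hdist, ENNReal.ofReal_eq_ofReal_iff (pairDist_nonneg _ _) (pairDist_nonneg _ _)] at hb'a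
    rwa [huniq a (haε.trans hε.2.2) b hb b' hb' hmin fun c hc => hb'a.trans_le (hmin c hc)]
  · exact fun hu => ⟨k, hgreat, b, hb, hdist.symm, hu⟩

end NumGCD

theorem mainTheorem2 (m n k : ℕ) (a₀ : ℂ[X] × ℂ[X]) (ha₀ : a₀ ∈ NumGCD.gcdManifold m n k) :
    ∃ θ : ℝ, 0 < θ ∧
      -- existence, uniqueness up to constant factors, and degree `k`
      (∀ a ∈ NumGCD.pairsOfDegree m n, ∀ ε : ℝ, NumGCD.pairDist a a₀ < ε → ε < θ →
        ∃ u : ℂ[X], u.degree = k ∧ NumGCD.numericalGCDs m n ε a = {f | NumGCD.Sim f u}) ∧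
      -- convergence of the class of numerical GCDs to the class of exact GCDs
      (∀ ε : ℝ, 0 < ε → ε < θ → ∀ u₀ ∈ NumGCD.exactGCDs a₀, ∀ η : ℝ, 0 < η →
        ∃ δ : ℝ, 0 < δ ∧ ∀ a ∈ NumGCD.pairsOfDegree m n, NumGCD.pairDist a a₀ < δ →
          ∃ u ∈ NumGCD.numericalGCDs m n ε a, NumGCD.polyNorm (u - u₀) < η) ∧
      -- consistency with the exact GCD
      (∀ ε : ℝ, 0 < ε → ε < θ →
        NumGCD.numericalGCDs m n ε a₀ = NumGCD.exactGCDs a₀) := by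
  open NumGCD in
  obtain ⟨m, rfl⟩ := Nat.exists_eq_add_of_le (le_of_mem_gcdManifold ha₀).1
  obtain ⟨n, rfl⟩ := Nat.exists_eq_add_of_le (le_of_mem_gcdManifold ha₀).2
  obtain ⟨θ, hθ, h⟩ := exists_pos_numericalGCDs_eq ha₀
  refine ⟨θ, hθ, fun a _ ε haε hε => ?_, fun ε hε0 hε u₀ hu₀ η hη => ?_, fun ε hε0 hε => ?_⟩
  · obtain ⟨b, ⟨hb, u, hu, huk⟩, heq, -⟩ := h a ε haε hε
    exact ⟨u, huk, heq.trans (exactGCDs_eq (fst_ne_zero hb) hu)⟩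
  · obtain ⟨z₀, hz₀, hza₀⟩ := exists_factors_of_le ha₀ le_rfl rfl rfl
    have hu₀z := hu₀
    rw [exactGCDs_eq (fst_ne_zero ha₀.1) (fst_mem_exactGCDs hz₀ ha₀ hza₀)] at hu₀z
    obtain ⟨α, hα, rfl⟩ := hu₀z
    have hα0 : 0 < ‖α‖ := norm_pos_iff.2 hα
    obtain ⟨ρ, hρ, hinv⟩ := exists_pos_dist_factors_lt ha₀ hz₀ hza₀ (div_pos hη hα0)
    refine ⟨min ε (ρ / 2), by positivity, fun a _ haδ => ?_⟩
    obtain ⟨b, hb, heq, hba⟩ := h a ε (haδ.trans_le (min_le_left _ _)) hε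
    obtain ⟨z, hz, hzb⟩ := exists_factors_of_le hb le_rfl rfl rfl
    have hd : dist z z₀ < η / ‖α‖ := by
      refine hinv z hz ?_
      have := haδ.trans_le (min_le_right _ _)
      rw [pairDist_eq_dist] at this
      rw [pairDist_eq_dist, pairDist_eq_dist, dist_comm (WithLp.toLp 2 a₀)] at hba
      rw [hzb]
      linarith [dist_triangle (WithLp.toLp 2 b) (WithLp.toLp 2 a) (WithLp.toLp 2 a₀)]
    refine ⟨C α * z.1, ?_, ?_⟩
    · rw [heq, exactGCDs_eq (fst_ne_zero hb.1) (fst_mem_exactGCDs hz hb hzb)]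
      exact ⟨α, hα, rfl⟩
    · rw [polyNorm_eq_norm, ← mul_sub, ← smul_eq_C_mul, norm_smul, ← lt_div_iff₀' hα0,
        ← dist_eq_norm]
      exact (le_max_left _ _).trans_lt hd
  · have h0 : pairDist a₀ a₀ = 0 := by rw [pairDist_eq_dist, dist_self]
    obtain ⟨b, -, heq, hb⟩ := h a₀ ε (by rwa [h0]) hε
    rw [h0, pairDist_eq_dist] at hb
    rw [heq, show b = a₀ from congrArg WithLp.ofLp (dist_le_zero.1 hb)]
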